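/- Let $\gamma_i,\gamma_e>1$, $\mu_i,\mu_e>0$, $\mu=\mu_i+\mu_e$, and let a pre-shock state $\tau_->0$, $p_{i,-},p_{e,-}>0$ be given; put $p_-=p_{i,-}+p_{e,-}$. Ions and electrons are polytropic gases: for $k\in\{i,e\}$ the specific internal energy and the specific entropy at pressure $p_k>0$ and specific volume $\tau>0$ are $$e_k=\frac{p_k\tau}{\gamma_k-1},\qquad s_k=\frac1{\gamma_k-1}\ln\frac{p_k\tau^{\gamma_k}}{\gamma_k-1},$$ and $e_{k,-}$ is the value of $e_k$ at $(p_{k,-},\tau_-)$. For $M\in\mathbb R$ let $(\pi_i(\cdot\,;M),\pi_e(\cdot\,;M))$ be the travelling-wave pressures with squared mass flux $m^2=M$, that is, the unique solution on $(0,\infty)$ of $$\frac{d}{d\tau}\Big(\frac{\pi_k\tau}{\gamma_k-1}\Big)+\pi_k=\frac{\mu_k}{\mu}\Big[M(\tau-\tau_-)+\pi_i+\pi_e-p_-\Big],\qquad \pi_k(\tau_-;M)=p_{k,-},\qquad k=i,e.$$ A post-shock state $(\tau,p_i,p_e)$ with $0<\tau<\tau_-$ satisfies the vanishing-viscosity Hugoniot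 relation $(\mathrm H^{\mathrm{vis}})$ of the two-temperature Euler system if, with $p=p_i+p_e$ and $m^2=\dfrac{p-p_-}{\tau_--\tau}$, $$e_i-e_{i,-}+\frac{\mu_i}{\mu}\,\frac{p_-+p}{2}(\tau-\tau_-)+\frac{\mu_e}{\mu}\int_{\tau_-}^{\tau}\pi_i(\omega;m^2)\,d\omega-\frac{\mu_i}{\mu}\int_{\tau_-}^{\tau}\pi_e(\omega;m^2)\,d\omega=0,$$ $$e_e-e_{e,-}+\frac{\mu_e}{\mu}\,\frac{p_-+p}{2}(\tau-\tau_-)+\frac{\mu_i}{\mu}\int_{\tau_-}^{\tau}\pi_e(\omega;m^2)\,d\omega-\frac{\mu_e}{\mu}\int_{\tau_-}^{\tau}\pi_i(\omega;m^2)\,d\omega=0,$$ where $e_k$ is evaluated at $(p_k,\tau)$. Theorem. There is $\hat\tau\in(0,\tau_-)$ such that for every $\tau\in(\hat\tau,\tau_-)$ exactly one pair $(p_i(\tau),p_e(\tau))\in\mathbb R^2$ satisfies $(\mathrm H^{\mathrm{vis}})$; this defines the Hugoniot curve near $\tau_-$. On $(\hat\tau,\tau_-)$ the functions $p_i,p_e$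 are differentiable and positive, $m^2>0$, $(p_i(\tau),p_e(\tau))\to(p_{i,-},p_{e,-})$ as $\tau\uparrow\tau_-$, and the Hugoniot curve is entropy productive: $$\frac{d}{d\tau}s_i\big(p_i(\tau),\tau\big)<0,\qquad \frac{d}{d\tau}s_e\big(p_e(\tau),\tau\big)<0\qquad\text{for all }\tau\in(\hat\tau,\tau_-).$$ -/

import Mathlib

open Set Filter Topology

noncomputable section

namespace TwoTemp

/-- Parameters of the two-temperature Euler system (adiabatic exponents `γi`, `γe` and viscosities
`μi`, `μe` of ions and electrons) with a pre-shock state (specific volume `τm = τ₋`, pressures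
`pim = p_{i,-}`, `pem = p_{e,-}`). -/
structure ShockData where
  γi : ℝ
  γe : ℝ
  μi : ℝ
  μe : ℝ
  τm : ℝ
  pim : ℝ
  pem : ℝ

/-- Specific internal energy of a polytropic gas, from the equation of state
`p = (γ - 1) ρ e` with `τ = 1 / ρ`. -/
def internalEnergy (γ p τ : ℝ) : ℝ := p * τ / (γ - 1)

/-- Specific physical entropy of a polytropic gas,
`s = (γ - 1)⁻¹ ln (p τ ^ γ / (γ - 1))`. -/
def entropy (γ p τ : ℝ) : ℝ := 1 / (γ - 1) * Real.log (p * τ ^ γ / (γ - 1))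

/-- Total viscosity `μ = μi + μe`. -/
def ShockData.μ (D : ShockData) : ℝ := D.μi + D.μe

/-- Total pre-shock pressure `p₋`. -/
def ShockData.pm (D : ShockData) : ℝ := D.pim + D.pem

/-- The defect `ℱ` of the Rankine-Hugoniot relation for the momentum: here `M` stands for `m²`,
the square of the mass flux across the shock, and `pi`, `pe` are the current pressures. -/
def ShockData.momentumDefect (D : ShockData) (τ M pi pe : ℝ) : ℝ :=
  M * (τ - D.τm) + (pi + pe - D.pim - D.pem)

/-- `(πi, πe)` are the pressures, as functions of the specific volume, of the travelling wave
with squared mass flux `M = m²` issuing from the pre-shock state: the integral curve of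
`de_k/dτ + p_k = (μ_k/μ) ℱ(τ, m²)`, `k = i, e`, with `p_k = p_{k,-}` at `τ = τ₋`. The system is
linear, so this curve exists, and is unique, on `(0, ∞)`. -/
structure ShockData.IsWaveCurve (D : ShockData) (M : ℝ) (πi πe : ℝ → ℝ) : Prop where
  init_i : πi D.τm = D.pim
  init_e : πe D.τm = D.pem
  ode_i : ∀ ω, 0 < ω → HasDerivAt (fun w => internalEnergy D.γi (πi w) w)
    (D.μi / D.μ * D.momentumDefect ω M (πi ω) (πe ω) - πi ω) ω
  ode_e : ∀ ω, 0 < ω → HasDerivAt (fun w => internalEnergy D.γe (πe w) w)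
    (D.μe / D.μ * D.momentumDefect ω M (πi ω) (πe ω) - πe ω) ω

/-- `m²` as determined by the pre- and post-shock states, `(p - p₋) / (τ₋ - τ)`. -/
def ShockData.massFluxSq (D : ShockData) (τ pi pe : ℝ) : ℝ :=
  (pi + pe - D.pm) / (D.τm - τ)

/-- The vanishing viscosity Hugoniot relation between the pre-shock state and the post-shock state
`(τ, pi, pe)` with `0 < τ < τ₋`. -/
def ShockData.HugoniotVis (D : ShockData) (τ pi pe : ℝ) : Prop :=
  0 < τ ∧ τ < D.τm ∧
  ∃ πi πe : ℝ → ℝ, D.IsWaveCurve (D.massFluxSq τ pi pe) πi πe ∧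
    internalEnergy D.γi pi τ - internalEnergy D.γi D.pim D.τm
        + D.μi / D.μ * ((D.pm + (pi + pe)) / 2) * (τ - D.τm)
        + D.μe / D.μ * (∫ ω in D.τm..τ, πi ω) - D.μi / D.μ * (∫ ω in D.τm..τ, πe ω) = 0 ∧
    internalEnergy D.γe pe τ - internalEnergy D.γe D.pem D.τm
        + D.μe / D.μ * ((D.pm + (pi + pe)) / 2) * (τ - D.τm)
        + D.μi / D.μ * (∫ ω in D.τm..τ, πe ω) - D.μe / D.μ * (∫ ω in D.τm..τ, πi ω) = 0

end TwoTemp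

end

namespace TwoTemp

/-! Integrating the wave equations from τ₋ to τ shows that (H^vis) says exactly that the wave with
mass flux m² passes through the post-shock state (`hugoniotVis_iff`). The system is linear, so its
pressures are a_k + M b_k, and consistency of m² with the jump means that the momentum defect F + M
G vanishes at τ. As G ≠ 0 left of τ₋, this forces M = -F/G: the Hugoniot curve is explicit
(`hugoniotVis_iff_eq`).

On that curve the viscous terms cancel: τ p_k' + γ_k p_k = τ M' b_k, which has the sign of the
entropy derivative. It remains to see b_k > 0, which follows from τ b_k' + γ_k b_k = κ_k G < 0
(`WaveSystem.pos_left`), and M' < 0, which is a sign for the Wronskian F'G - FG'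
(`exists_hasDerivAt_shockFlux_neg`). Both signs come from integrating factors t^c. -/

/-- The travelling wave system solved for the derivatives of the pressures `u`, `v`, with
`κ_k = (γ_k - 1) μ_k / μ`, squared mass flux `M` and data `(p, q)` at `T`. -/
structure WaveSystem (γi γe κi κe T M p q : ℝ) (u v : ℝ → ℝ) : Prop where
  init_i : u T = p
  init_e : v T = q
  ode_i : ∀ t, 0 < t →
    HasDerivAt u ((-γi * u t + κi * (M * (t - T) + (u t + v t - p - q))) / t) t
  ode_e : ∀ t, 0 < t →
    HasDerivAt v ((-γe * v t + κe * (M * (t - T) + (u t + v t - p - q))) / t) t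

/-! ### Existence of the travelling wave -/

/-- The Euler system `t X' = A X` with constant coefficients is solved by
`exp (log (t / T) A) x₀`. -/
lemma exists_euler_solution {E : Type*} [NormedAddCommGroup E] [NormedSpace ℝ E] [CompleteSpace E]
    (A : E →L[ℝ] E) (T : ℝ) (x₀ : E) :
    ∃ X : ℝ → E, X T = x₀ ∧ ∀ t, 0 < t → HasDerivAt X (t⁻¹ • A (X t)) t := by
  refine ⟨fun t => NormedSpace.exp ((Real.log t - Real.log T) • A) x₀, ?_, fun t ht => ?_⟩
  · simp only [sub_self, zero_smul, NormedSpace.exp_zero]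
    rfl
  · have h1 : HasDerivAt (fun t => Real.log t - Real.log T) t⁻¹ t :=
      (Real.hasDerivAt_log ht.ne').sub_const _
    have h2 : HasDerivAt (fun u : ℝ => NormedSpace.exp (u • A))
        (A * NormedSpace.exp ((Real.log t - Real.log T) • A)) (Real.log t - Real.log T) :=
      hasDerivAt_exp_smul_const' (𝕂 := ℝ) A _
    exact ((ContinuousLinearMap.apply ℝ E x₀).hasFDerivAt).comp_hasDerivAt t
      (HasDerivAt.scomp t h2 h1)

lemma eq_of_hasDerivAt_zero {f : ℝ → ℝ} (hf : ∀ t, 0 < t → HasDerivAt f 0 t) {s t : ℝ}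
    (hs : 0 < s) (ht : 0 < t) : f s = f t :=
  isOpen_Ioi.is_const_of_deriv_eq_zero isPreconnected_Ioi
    (fun x hx => (hf x hx).differentiableAt.differentiableWithinAt)
    (fun x hx => (hf x hx).deriv) hs ht

lemma WaveSystem.exists_solution (γi γe κi κe M p q : ℝ) {T : ℝ} (hT : 0 < T) :
    ∃ u v : ℝ → ℝ, WaveSystem γi γe κi κe T M p q u v := by
  -- Taking the momentum defect and `M * t` as third and fourth unknowns makes the affine system a
  -- homogeneous Euler system.
  let A : (Fin 4 → ℝ) →L[ℝ] (Fin 4 → ℝ) := LinearMap.toContinuousLinearMap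
    (Matrix.toLin' !![-γi, 0, κi, 0; 0, -γe, κe, 0; -γi, -γe, κi + κe, 1; 0, 0, 0, 1])
  obtain ⟨X, h0, hX⟩ := exists_euler_solution A T ![p, q, 0, M * T]
  have hc := fun t ht => hasDerivAt_pi.1 (hX t ht)
  have h1 : ∀ t, 0 < t → HasDerivAt (fun t => X t 0) ((-γi * X t 0 + κi * X t 2) / t) t := by
    intro t ht
    refine HasDerivAt.congr_deriv (hc t ht 0) ?_
    simp [A, dotProduct, Fin.sum_univ_four]
    ring
  have h2 : ∀ t, 0 < t → HasDerivAt (fun t => X t 1) ((-γe * X t 1 + κe * X t 2) / t) t := by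
    intro t ht
    refine HasDerivAt.congr_deriv (hc t ht 1) ?_
    simp [A, dotProduct, Fin.sum_univ_four]
    ring
  have h3 : ∀ t, 0 < t → HasDerivAt (fun t => X t 2)
      ((-γi * X t 0 - γe * X t 1 + (κi + κe) * X t 2 + X t 3) / t) t := by
    intro t ht
    refine HasDerivAt.congr_deriv (hc t ht 2) ?_
    simp [A, dotProduct, Fin.sum_univ_four]
    ring
  have h4 : ∀ t, 0 < t → HasDerivAt (fun t => X t 3) (X t 3 / t) t := by
    intro t ht
    refine HasDerivAt.congr_deriv (hc t ht 3) ?_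
    simp [A, dotProduct, Fin.sum_univ_four]
    ring
  have hz : ∀ t, 0 < t → X t 3 = M * t := by
    intro t ht
    have := eq_of_hasDerivAt_zero (f := fun t => X t 3 / t) (fun s hs => by
      refine HasDerivAt.congr_deriv ((h4 s hs).div (hasDerivAt_id s) hs.ne') ?_
      field_simp
      simp) ht hT
    simp only [h0] at this
    rw [div_eq_iff ht.ne'] at this
    simpa [hT.ne'] using this
  have hF : ∀ t, 0 < t → X t 2 = M * (t - T) + (X t 0 + X t 1 - p - q) := by
    intro t ht
    have := eq_of_hasDerivAt_zero (f := fun t => X t 2 - X t 3 - X t 0 - X t 1) (fun s hs => by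
      refine HasDerivAt.congr_deriv ((((h3 s hs).sub (h4 s hs)).sub (h1 s hs)).sub (h2 s hs)) ?_
      ring) ht hT
    simp [h0, hz t ht] at this
    linarith
  refine ⟨fun t => X t 0, fun t => X t 1, by simp [h0], by simp [h0], fun t ht => ?_,
    fun t ht => ?_⟩
  · simpa only [← hF t ht] using h1 t ht
  · simpa only [← hF t ht] using h2 t ht

/-! ### Integrating factors, uniqueness and superposition -/

lemma hasDerivAt_rpow_mul {f : ℝ → ℝ} {f' c t : ℝ} (ht : 0 < t) (hf : HasDerivAt f f' t) :
    HasDerivAt (fun t => t ^ c * f t) (t ^ (c - 1) * (t * f' + c * f t)) t := by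
  refine HasDerivAt.congr_deriv ((Real.hasDerivAt_rpow_const (p := c) (Or.inl ht.ne')).mul hf) ?_
  rw [Real.rpow_sub_one ht.ne']
  field_simp
  ring

/-- Integrating factor: if `t f' + c f < 0` to the left of a zero `T` of `f`, then `f` is positive
there. -/
lemma pos_of_euler_neg {f f' : ℝ → ℝ} {c s T : ℝ} (hs : 0 < s) (hT : f T = 0)
    (hf : ∀ t, 0 < t → HasDerivAt f (f' t) t)
    (hneg : ∀ t ∈ Ioo s T, t * f' t + c * f t < 0) {t : ℝ} (ht : t ∈ Ioo s T) : 0 < f t := by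
  have ht0 : 0 < t := hs.trans ht.1
  have hd := fun r (hr : 0 < r) => hasDerivAt_rpow_mul (c := c) hr (hf r hr)
  have hanti : StrictAntiOn (fun t => t ^ c * f t) (Icc t T) := by
    refine strictAntiOn_of_deriv_neg (convex_Icc _ _)
      (fun r hr => (hd r (ht0.trans_le hr.1)).continuousAt.continuousWithinAt) fun r hr => ?_
    rw [interior_Icc] at hr
    have hr0 := ht0.trans hr.1
    rw [(hd r hr0).deriv]
    exact mul_neg_of_pos_of_neg (Real.rpow_pos_of_pos hr0 _) (hneg r ⟨ht.1.trans hr.1, hr.2⟩)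
  have := hanti (left_mem_Icc.2 ht.2.le) (right_mem_Icc.2 ht.2.le) ht.2
  simp only [hT, mul_zero] at this
  exact pos_of_mul_pos_right this (Real.rpow_pos_of_pos ht0 _).le

lemma nonpos_of_euler_nonneg {f f' : ℝ → ℝ} {c T : ℝ} (hT : f T = 0)
    (hf : ∀ t, 0 < t → HasDerivAt f (f' t) t)
    (hnn : ∀ t, 0 < t → 0 ≤ t * f' t + c * f t) {t : ℝ} (ht : 0 < t) (htT : t ≤ T) : f t ≤ 0 := by
  have hd := fun r (hr : 0 < r) => hasDerivAt_rpow_mul (c := c) hr (hf r hr)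
  have hmono : MonotoneOn (fun t => t ^ c * f t) (Ioi 0) := by
    refine monotoneOn_of_deriv_nonneg (convex_Ioi _)
      (fun r hr => (hd r hr).continuousAt.continuousWithinAt)
      (fun r hr => (hd r (interior_subset hr)).differentiableAt.differentiableWithinAt)
      fun r hr => ?_
    rw [interior_Ioi] at hr
    rw [(hd r hr).deriv]
    exact mul_nonneg (Real.rpow_pos_of_pos hr _).le (hnn r hr)
  have := hmono (mem_Ioi.2 ht) (mem_Ioi.2 (ht.trans_le htT)) htT
  simp only [hT, mul_zero] at this
  exact nonpos_of_mul_nonpos_right this (Real.rpow_pos_of_pos ht _)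

lemma WaveSystem.unique {γi γe κi κe T M p q : ℝ} {u v u' v' : ℝ → ℝ}
    (hγi : 0 ≤ γi) (hγe : 0 ≤ γe) (hκi : 0 ≤ κi) (hκe : 0 ≤ κe)
    (h : WaveSystem γi γe κi κe T M p q u v) (h' : WaveSystem γi γe κi κe T M p q u' v')
    {t : ℝ} (ht : 0 < t) (htT : t ≤ T) : u t = u' t ∧ v t = v' t := by
  -- Grönwall backwards from `T`: this `c` is large enough to turn `t f' + c f`, for the squared
  -- distance `f`, into the sum of squares `h1`.
  have key := nonpos_of_euler_nonneg (c := 2 * (γi + γe + κi + κe)) (T := T)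
    (f := fun t => (u t - u' t) ^ 2 + (v t - v' t) ^ 2) (by
      simp [h.init_i, h'.init_i, h.init_e, h'.init_e])
    (fun s hs => (((h.ode_i s hs).sub (h'.ode_i s hs)).fun_pow 2).add
      (((h.ode_e s hs).sub (h'.ode_e s hs)).fun_pow 2)) (fun s hs => by
      set d := u s - u' s with hd
      set e := v s - v' s with he
      have h1 : 0 ≤ 2 * γe * d ^ 2 + 2 * γi * e ^ 2 + (κi + κe) * (d + e) ^ 2
          + (3 * κi + κe) * d ^ 2 + (3 * κe + κi) * e ^ 2 := by positivity
      refine h1.trans (le_of_eq ?_)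
      simp only [Pi.sub_apply, ← hd, ← he]
      field_simp
      rw [hd, he]
      ring) ht htT
  constructor <;> nlinarith [sq_nonneg (u t - u' t), sq_nonneg (v t - v' t)]

lemma WaveSystem.add_smul {γi γe κi κe T p q : ℝ} {ai ae bi be : ℝ → ℝ}
    (ha : WaveSystem γi γe κi κe T 0 p q ai ae) (hb : WaveSystem γi γe κi κe T 1 0 0 bi be)
    (M : ℝ) :
    WaveSystem γi γe κi κe T M p q (fun t => ai t + M * bi t) (fun t => ae t + M * be t) where
  init_i := by simp [ha.init_i, hb.init_i]
  init_e := by simp [ha.init_e, hb.init_e]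
  ode_i t ht := by
    refine HasDerivAt.congr_deriv ((ha.ode_i t ht).add ((hb.ode_i t ht).const_mul M)) ?_
    ring
  ode_e t ht := by
    refine HasDerivAt.congr_deriv ((ha.ode_e t ht).add ((hb.ode_e t ht).const_mul M)) ?_
    ring

/-! ### The Hugoniot relation as an integrated wave equation -/

lemma hasDerivAt_internalEnergy_iff {γ G t : ℝ} {u : ℝ → ℝ} (hγ : 1 < γ) (ht : 0 < t) :
    HasDerivAt (fun w => internalEnergy γ (u w) w) (G - u t) t ↔
      HasDerivAt u ((-γ * u t + (γ - 1) * G) / t) t := by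
  have hγ' : γ - 1 ≠ 0 := (sub_pos.2 hγ).ne'
  unfold internalEnergy
  constructor <;> intro h
  · have h1 := (h.mul_const (γ - 1)).div (hasDerivAt_id t) ht.ne'
    refine (h1.congr_of_eventuallyEq ?_).congr_deriv ?_
    · filter_upwards [lt_mem_nhds ht] with w hw
      simp only [id, Pi.div_apply]
      field_simp
    · simp only [id]
      field_simp
      ring
  · refine ((h.mul (hasDerivAt_id t)).div_const (γ - 1)).congr_deriv ?_
    simp only [id]
    field_simp
    ring

lemma isWaveCurve_iff {D : ShockData} (hγi : 1 < D.γi) (hγe : 1 < D.γe) {M : ℝ} {u v : ℝ → ℝ} :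
    D.IsWaveCurve M u v ↔ WaveSystem D.γi D.γe ((D.γi - 1) * (D.μi / D.μ))
      ((D.γe - 1) * (D.μe / D.μ)) D.τm M D.pim D.pem u v := by
  have key : ∀ {γ ν w : ℝ} {f : ℝ → ℝ}, 1 < γ → ∀ t, 0 < t →
      (HasDerivAt (fun s => internalEnergy γ (f s) s) (ν * w - f t) t ↔
        HasDerivAt f ((-γ * f t + (γ - 1) * ν * w) / t) t) := fun hγ t ht => by
    rw [hasDerivAt_internalEnergy_iff hγ ht, mul_assoc]
  constructor <;> rintro ⟨h1, h2, h3, h4⟩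
  · exact ⟨h1, h2, fun t ht => (key hγi t ht).1 (h3 t ht), fun t ht => (key hγe t ht).1 (h4 t ht)⟩
  · exact ⟨h1, h2, fun t ht => (key hγi t ht).2 (h3 t ht), fun t ht => (key hγe t ht).2 (h4 t ht)⟩

/-- Integrating the wave system from `τm` to `τ` gives the internal energy balance of one
species, `w` being the share of this species in the viscosity. -/
lemma internalEnergy_sub_eq {γ w M T p q t : ℝ} {u v : ℝ → ℝ} (ht : 0 < t)
    (hT : 0 < T)
    (hu : ∀ s, 0 < s → ContinuousAt u s) (hv : ∀ s, 0 < s → ContinuousAt v s)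
    (h : ∀ s, 0 < s → HasDerivAt (fun r => internalEnergy γ (u r) r)
      (w * (M * (s - T) + (u s + v s - p - q)) - u s) s) :
    internalEnergy γ (u t) t - internalEnergy γ (u T) T =
      w * (M * (t - T) ^ 2 / 2 - (p + q) * (t - T)) - (1 - w) * (∫ s in T..t, u s)
        + w * ∫ s in T..t, v s := by
  have hpos : ∀ s ∈ uIcc T t, 0 < s := fun s hs => (lt_min hT ht).trans_le hs.1
  have hiu : IntervalIntegrable u MeasureTheory.volume T t :=
    ContinuousOn.intervalIntegrable fun s hs => (hu s (hpos s hs)).continuousWithinAt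
  have hiv : IntervalIntegrable v MeasureTheory.volume T t :=
    ContinuousOn.intervalIntegrable fun s hs => (hv s (hpos s hs)).continuousWithinAt
  have hil : IntervalIntegrable (fun s => w * (M * (s - T) - (p + q))) MeasureTheory.volume T t :=
    Continuous.intervalIntegrable (by fun_prop) _ _
  have hlin : ∫ s in T..t, w * (M * (s - T) - (p + q)) =
      w * (M * (t - T) ^ 2 / 2 - (p + q) * (t - T)) := by
    rw [intervalIntegral.integral_eq_sub_of_hasDerivAt
      (f := fun s => w * (M * (s - T) ^ 2 / 2 - (p + q) * (s - T))) (fun s _ => ?_) hil]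
    · ring
    · have h1 := (hasDerivAt_id s).sub_const T
      refine (((((h1.fun_pow 2).const_mul M).div_const 2).sub
        (h1.const_mul (p + q))).const_mul w).congr_deriv ?_
      simp only [id, Nat.cast_ofNat]
      ring
  have hsplit : (fun s => w * (M * (s - T) + (u s + v s - p - q)) - u s) =
      fun s => w * (M * (s - T) - (p + q)) - (1 - w) * u s + w * v s := by
    funext s
    ring
  have h1 := intervalIntegral.integral_eq_sub_of_hasDerivAt (fun s hs => h s (hpos s hs))
    (by rw [hsplit]; exact (hil.sub (hiu.const_mul _)).add (hiv.const_mul _))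
  rw [← h1, hsplit, intervalIntegral.integral_add (hil.sub (hiu.const_mul _)) (hiv.const_mul _),
    intervalIntegral.integral_sub hil (hiu.const_mul _), hlin,
    intervalIntegral.integral_const_mul, intervalIntegral.integral_const_mul]

lemma internalEnergy_inj {γ x y t : ℝ} (hγ : 1 < γ) (ht : 0 < t) :
    internalEnergy γ x t = internalEnergy γ y t ↔ x = y := by
  have hγ' : γ - 1 ≠ 0 := (sub_pos.2 hγ).ne'
  unfold internalEnergy
  rw [div_left_inj' hγ', mul_left_inj' ht.ne']

/-- The vanishing viscosity Hugoniot relation says that the travelling wave with the mass flux of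
the shock reaches the post-shock state. -/
lemma hugoniotVis_iff {D : ShockData} (hγi : 1 < D.γi) (hγe : 1 < D.γe) (hμ : D.μ ≠ 0)
    {τ x y : ℝ} (hτ0 : 0 < τ) (hτm : τ < D.τm) :
    D.HugoniotVis τ x y ↔
      ∃ πi πe : ℝ → ℝ, D.IsWaveCurve (D.massFluxSq τ x y) πi πe ∧ x = πi τ ∧ y = πe τ := by
  simp only [ShockData.HugoniotVis, hτ0, hτm, true_and]
  refine exists_congr fun u => exists_congr fun v => and_congr_right fun h => ?_
  have hs := (isWaveCurve_iff hγi hγe).1 h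
  have hui := fun s hs0 => (hs.ode_i s hs0).continuousAt
  have hvi := fun s hs0 => (hs.ode_e s hs0).continuousAt
  -- This turns the quadratic term of the energy balance into the mean pressure `(p₋ + p) / 2` of
  -- the Hugoniot relation.
  have hM : D.massFluxSq τ x y * (τ - D.τm) ^ 2 = - (x + y - D.pm) * (τ - D.τm) := by
    have : D.τm - τ ≠ 0 := (sub_pos.2 hτm).ne'
    unfold ShockData.massFluxSq
    field_simp
    ring
  have hT := hτ0.trans hτm
  have e1 := internalEnergy_sub_eq hτ0 hT hui hvi h.ode_i
  have e2 := internalEnergy_sub_eq (w := D.μe / D.μ) (M := D.massFluxSq τ x y) (p := D.pim)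
    (q := D.pem) hτ0 hT hvi hui (fun s hs0 => by
      convert h.ode_e s hs0 using 3
      rw [ShockData.momentumDefect, add_comm (v s)])
  rw [hM, h.init_i] at e1
  rw [hM, h.init_e] at e2
  have hw : D.μi / D.μ = 1 - D.μe / D.μ := by
    rw [eq_sub_iff_add_eq, ← add_div, ← ShockData.μ, div_self hμ]
  rw [← internalEnergy_inj (x := x) hγi hτ0, ← internalEnergy_inj (x := y) hγe hτ0]
  have hpm : D.pm = D.pim + D.pem := rfl
  rw [hw] at e1 ⊢
  rw [hpm] at e1 e2 ⊢
  constructor <;> rintro ⟨k1, k2⟩ <;> constructor <;> linarith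

/-! ### Entropy, momentum defect and shock mass flux -/

lemma eventually_left_neg {f : ℝ → ℝ} {f' T : ℝ} (hf : HasDerivAt f f' T) (hT : f T = 0)
    (hf' : 0 < f') : ∀ᶠ t in 𝓝[<] T, f t < 0 := by
  have h := (hasDerivWithinAt_iff_tendsto_slope' (show T ∉ Iio T from lt_irrefl T)).1
    (hf.hasDerivWithinAt (s := Iio T))
  filter_upwards [h.eventually_const_lt hf', self_mem_nhdsWithin] with t ht htT
  rw [slope_def_field, hT, sub_zero] at ht
  by_contra! hneg
  exact absurd (div_nonpos_of_nonneg_of_nonpos hneg (sub_neg.2 htT).le) ht.not_ge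

/-- The entropy derivative equals `(t f' + γ f) / ((γ - 1) f t)`. -/
lemma deriv_entropy_neg {γ f' t : ℝ} {f : ℝ → ℝ} (hγ : 1 < γ) (ht : 0 < t) (hft : 0 < f t)
    (hf : HasDerivAt f f' t) (hneg : t * f' + γ * f t < 0) :
    deriv (fun s => entropy γ (f s) s) t < 0 := by
  have hγ' : 0 < γ - 1 := sub_pos.2 hγ
  have hpow : 0 < t ^ γ := Real.rpow_pos_of_pos ht _
  have h1 : HasDerivAt (fun s => entropy γ (f s) s) _ t :=
    (((hf.mul (Real.hasDerivAt_rpow_const (p := γ) (Or.inl ht.ne'))).div_const (γ - 1)).log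
      (div_pos (mul_pos hft hpow) hγ').ne').const_mul (1 / (γ - 1))
  have h2 : HasDerivAt (fun s => entropy γ (f s) s)
      ((t * f' + γ * f t) / ((γ - 1) * (f t * t))) t := by
    refine h1.congr_deriv ?_
    rw [Real.rpow_sub_one ht.ne']
    simp only [Pi.mul_apply]
    field_simp
  rw [h2.deriv]
  exact div_neg_of_neg_of_pos hneg (by positivity)

/-- The momentum defect along `(u, v)`. With pressures `a + M b` it is affine in `M`. -/
def defect (T M p q : ℝ) (u v : ℝ → ℝ) (t : ℝ) : ℝ := M * (t - T) + (u t + v t - p - q)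

section

variable {γi γe κi κe T M p q : ℝ} {u v : ℝ → ℝ}

lemma WaveSystem.defect_self (h : WaveSystem γi γe κi κe T M p q u v) :
    defect T M p q u v T = 0 := by
  simp [defect, h.init_i, h.init_e]

lemma WaveSystem.hasDerivAt_defect (h : WaveSystem γi γe κi κe T M p q u v) {t : ℝ} (ht : 0 < t) :
    HasDerivAt (defect T M p q u v)
      ((M * t - γi * u t - γe * v t + (κi + κe) * defect T M p q u v t) / t) t := by
  have h1 := (((hasDerivAt_id t).sub_const T).const_mul M).add
    ((((h.ode_i t ht).add (h.ode_e t ht)).sub_const p).sub_const q)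
  refine HasDerivAt.congr_deriv (f := defect T M p q u v) h1 ?_
  unfold defect
  field_simp
  ring

end

section

variable {γi γe κi κe T p q : ℝ} {ai ae bi be : ℝ → ℝ}

/-- The squared mass flux for which the momentum defect vanishes at `t`. -/
noncomputable def shockFlux (T p q : ℝ) (ai ae bi be : ℝ → ℝ) (t : ℝ) : ℝ :=
  -defect T 0 p q ai ae t / defect T 1 0 0 bi be t

/-- Both defects vanish at `T`, so the quotient is one of slopes and tends to the quotient of
derivatives; that of the denominator is 1. -/
lemma tendsto_shockFlux (hT : 0 < T)
    (ha : WaveSystem γi γe κi κe T 0 p q ai ae) (hb : WaveSystem γi γe κi κe T 1 0 0 bi be) :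
    Tendsto (shockFlux T p q ai ae bi be) (𝓝[<] T) (𝓝 ((γi * p + γe * q) / T)) := by
  have h0 := (hasDerivWithinAt_iff_tendsto_slope' (show T ∉ Iio T from lt_irrefl T)).1
    ((ha.hasDerivAt_defect hT).hasDerivWithinAt (s := Iio T))
  have h1 := (hasDerivWithinAt_iff_tendsto_slope' (show T ∉ Iio T from lt_irrefl T)).1
    ((hb.hasDerivAt_defect hT).hasDerivWithinAt (s := Iio T))
  simp only [ha.defect_self, hb.defect_self, ha.init_i, ha.init_e, hb.init_i, hb.init_e,
    mul_zero, zero_mul, one_mul, sub_zero, add_zero, div_self hT.ne'] at h0 h1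
  have h2 := h0.neg.div h1 one_ne_zero
  rw [show -((0 - γi * p - γe * q) / T) / 1 = (γi * p + γe * q) / T by ring] at h2
  refine h2.congr' ?_
  filter_upwards [self_mem_nhdsWithin] with t ht
  have : t - T ≠ 0 := (sub_neg.2 ht).ne
  simp only [Pi.div_apply, slope_def_field, ha.defect_self, hb.defect_self, sub_zero, shockFlux]
  rw [← neg_div, div_div_div_cancel_right₀ this]

/-- The mass flux along the curve of zero defect is strictly decreasing in the volume. -/
lemma exists_hasDerivAt_shockFlux_neg (hT : 0 < T) (hγi : 0 < γi) (hγe : 0 < γe)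
    (hp : 0 < p) (hq : 0 < q)
    (ha : WaveSystem γi γe κi κe T 0 p q ai ae) (hb : WaveSystem γi γe κi κe T 1 0 0 bi be) :
    ∃ s, 0 < s ∧ s < T ∧ ∀ t ∈ Ioo s T, defect T 1 0 0 bi be t < 0 ∧
      ∃ M', M' < 0 ∧ HasDerivAt (shockFlux T p q ai ae bi be) M' t := by
  set F := defect T 0 p q ai ae with hF
  set G := defect T 1 0 0 bi be with hG
  have hF' : ∀ t, 0 < t → HasDerivAt F _ t := fun t ht => ha.hasDerivAt_defect ht
  have hG' : ∀ t, 0 < t → HasDerivAt G _ t := fun t ht => hb.hasDerivAt_defect ht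
  have hFT : F T = 0 := ha.defect_self
  have hGT : G T = 0 := hb.defect_self
  -- `V` is `t (F' G - F G')`, and `t V' = (κi + κe) V + U`
  let V : ℝ → ℝ := fun t =>
    (-(γi * ai t) - γe * ae t) * G t - F t * (t - γi * bi t - γe * be t)
  let U : ℝ → ℝ := fun t =>
    (γi ^ 2 * ai t + γe ^ 2 * ae t) * G t - F t * (t + γi ^ 2 * bi t + γe ^ 2 * be t)
  have hV : ∀ t, 0 < t → HasDerivAt V (((κi + κe) * V t + U t) / t) t := fun t ht => by
    refine HasDerivAt.congr_deriv
      ((((((ha.ode_i t ht).const_mul γi).fun_neg).sub ((ha.ode_e t ht).const_mul γe)).mul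
        (hG' t ht)).sub ((hF' t ht).mul (((hasDerivAt_id t).sub
        ((hb.ode_i t ht).const_mul γi)).sub ((hb.ode_e t ht).const_mul γe)))) ?_
    simp only [Pi.sub_apply, ← hF, ← hG, V, U]
    have e1 : 0 * (t - T) + (ai t + ae t - p - q) = F t := rfl
    have e2 : 1 * (t - T) + (bi t + be t - 0 - 0) = G t := rfl
    rw [e1, e2]
    field_simp
    ring
  -- `U` vanishes at `T` with positive slope, hence is negative just to the left.
  have hU : HasDerivAt U (γi ^ 2 * p + γe ^ 2 * q + (γi * p + γe * q)) T := by
    refine HasDerivAt.congr_deriv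
      (((((ha.ode_i T hT).const_mul (γi ^ 2)).add ((ha.ode_e T hT).const_mul (γe ^ 2))).mul
        (hG' T hT)).sub ((hF' T hT).mul (((hasDerivAt_id T).add
        ((hb.ode_i T hT).const_mul (γi ^ 2))).add ((hb.ode_e T hT).const_mul (γe ^ 2))))) ?_
    simp only [Pi.add_apply, ← hF, ← hG, hFT, hGT, ha.init_i, ha.init_e, hb.init_i, hb.init_e]
    field_simp
    ring
  have hev := (eventually_left_neg (hG' T hT) hGT (by
      simp [← hG, hGT, hb.init_i, hb.init_e, hT.ne'])).and
    (eventually_left_neg hU (by simp [U, hFT, hGT]) (by positivity))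
  obtain ⟨s, hs, hsT⟩ := (mem_nhdsLT_iff_exists_Ioo_subset' (show T / 2 < T by linarith)).1 hev
  refine ⟨max s (T / 2), lt_max_of_lt_right (by linarith), max_lt hs (by linarith),
    fun t ht => ?_⟩
  have hsub : ∀ r ∈ Ioo (max s (T / 2)) T, G r < 0 ∧ U r < 0 :=
    fun r hr => hsT ⟨(le_max_left _ _).trans_lt hr.1, hr.2⟩
  have hpos : 0 < max s (T / 2) := lt_max_of_lt_right (by linarith)
  have ht0 : 0 < t := hpos.trans ht.1
  have hGt := (hsub t ht).1
  -- With this exponent, `t V' + c V` is exactly `U`.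
  have hVt : 0 < V t := pos_of_euler_neg (c := -(κi + κe)) hpos (by simp [V, hFT, hGT]) hV
    (fun r hr => by
      have hr0 : r ≠ 0 := (hpos.trans hr.1).ne'
      rw [mul_div_cancel₀ _ hr0]
      linarith [(hsub r hr).2]) ht
  refine ⟨hGt, -(V t / (t * G t ^ 2)),
    neg_neg_of_pos (div_pos hVt (mul_pos ht0 (sq_pos_of_neg hGt))), ?_⟩
  refine HasDerivAt.congr_deriv (((hF' t ht0).fun_neg).div (hG' t ht0) hGt.ne) ?_
  simp only [← hF, ← hG, V]
  have := hGt.ne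
  field_simp
  ring

end

lemma WaveSystem.pos_left {γi γe κi κe T s : ℝ} {bi be : ℝ → ℝ} (hκi : 0 < κi) (hκe : 0 < κe)
    (hs : 0 < s) (hb : WaveSystem γi γe κi κe T 1 0 0 bi be)
    (hG : ∀ t ∈ Ioo s T, defect T 1 0 0 bi be t < 0) {t : ℝ} (ht : t ∈ Ioo s T) :
    0 < bi t ∧ 0 < be t := by
  constructor
  · refine pos_of_euler_neg (c := γi) hs hb.init_i hb.ode_i (fun r hr => ?_) ht
    have := mul_neg_of_pos_of_neg hκi (hG r hr)
    rw [mul_div_cancel₀ _ (hs.trans hr.1).ne']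
    unfold defect at this
    linarith
  · refine pos_of_euler_neg (c := γe) hs hb.init_e hb.ode_e (fun r hr => ?_) ht
    have := mul_neg_of_pos_of_neg hκe (hG r hr)
    rw [mul_div_cancel₀ _ (hs.trans hr.1).ne']
    unfold defect at this
    linarith

/-- Along the curve of zero defect, the derivative of the entropy of a species has the sign of
`M' b`. -/
lemma deriv_entropy_curve_neg {γ κ F G M' t : ℝ} {a b M : ℝ → ℝ} (hγ : 1 < γ) (ht : 0 < t)
    (ha : HasDerivAt a ((-γ * a t + κ * F) / t) t) (hb : HasDerivAt b ((-γ * b t + κ * G) / t) t)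
    (hM : HasDerivAt M M' t) (hFG : F + M t * G = 0) (hM' : M' < 0) (hbt : 0 < b t)
    (hpos : 0 < a t + M t * b t) :
    deriv (fun s => entropy γ (a s + M s * b s) s) t < 0 := by
  refine deriv_entropy_neg hγ ht hpos (ha.add (hM.mul hb)) ?_
  have h : t * ((-γ * a t + κ * F) / t + (M' * b t + M t * ((-γ * b t + κ * G) / t)))
      + γ * (a t + M t * b t) = κ * (F + M t * G) + t * (M' * b t) := by
    field_simp
    ring
  rw [h, hFG, mul_zero, zero_add]
  exact mul_neg_of_pos_of_neg ht (mul_neg_of_neg_of_pos hM' hbt)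

/-! ### The explicit Hugoniot curve -/

/-- The flux fixes the end state and the end state fixes the flux; this fixed-point condition is
affine in `M`, so it has one solution. -/
lemma massFluxSq_eq_iff {D : ShockData} {ai ae bi be : ℝ → ℝ} {M t : ℝ} (ht : t < D.τm)
    (hG : defect D.τm 1 0 0 bi be t ≠ 0) :
    D.massFluxSq t (ai t + M * bi t) (ae t + M * be t) = M ↔
      M = shockFlux D.τm D.pim D.pem ai ae bi be t := by
  rw [ShockData.massFluxSq, shockFlux, div_eq_iff (sub_pos.2 ht).ne', eq_div_iff hG]
  unfold defect ShockData.pm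
  constructor <;> intro h <;> linarith

lemma hugoniotVis_iff_eq {D : ShockData} (hγi : 1 < D.γi) (hγe : 1 < D.γe) (hμi : 0 < D.μi)
    (hμe : 0 < D.μe) {ai ae bi be : ℝ → ℝ}
    (ha : WaveSystem D.γi D.γe ((D.γi - 1) * (D.μi / D.μ)) ((D.γe - 1) * (D.μe / D.μ))
      D.τm 0 D.pim D.pem ai ae)
    (hb : WaveSystem D.γi D.γe ((D.γi - 1) * (D.μi / D.μ)) ((D.γe - 1) * (D.μe / D.μ))
      D.τm 1 0 0 bi be) {t x y : ℝ} (ht0 : 0 < t) (ht : t < D.τm)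
    (hG : defect D.τm 1 0 0 bi be t ≠ 0) :
    D.HugoniotVis t x y ↔
      x = ai t + shockFlux D.τm D.pim D.pem ai ae bi be t * bi t ∧
      y = ae t + shockFlux D.τm D.pim D.pem ai ae bi be t * be t := by
  have hμ : 0 < D.μ := add_pos hμi hμe
  have hκi : 0 < (D.γi - 1) * (D.μi / D.μ) := mul_pos (sub_pos.2 hγi) (div_pos hμi hμ)
  have hκe : 0 < (D.γe - 1) * (D.μe / D.μ) := mul_pos (sub_pos.2 hγe) (div_pos hμe hμ)
  rw [hugoniotVis_iff hγi hγe hμ.ne' ht0 ht]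
  constructor
  · rintro ⟨u, v, h, hx, hy⟩
    obtain ⟨hu, hv⟩ := ((isWaveCurve_iff hγi hγe).1 h).unique (by linarith) (by linarith) hκi.le
      hκe.le (ha.add_smul hb _) ht0 ht.le
    rw [hu] at hx
    rw [hv] at hy
    have hM := (massFluxSq_eq_iff (ai := ai) (ae := ae) (M := D.massFluxSq t x y) ht hG).1 (by
      rw [← hx, ← hy])
    rw [← hM]
    exact ⟨hx, hy⟩
  · rintro ⟨hx, hy⟩
    refine ⟨_, _, (isWaveCurve_iff hγi hγe).2 (ha.add_smul hb _), ?_, ?_⟩ <;>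
      rw [hx, hy, (massFluxSq_eq_iff ht hG).2 rfl]

end TwoTemp

open TwoTemp

theorem mainTheorem1 (D : TwoTemp.ShockData)
    (hγi : 1 < D.γi) (hγe : 1 < D.γe) (hμi : 0 < D.μi) (hμe : 0 < D.μe)
    (hτ : 0 < D.τm) (hpi : 0 < D.pim) (hpe : 0 < D.pem) :
    ∃ τhat : ℝ, 0 < τhat ∧ τhat < D.τm ∧ ∃ pi pe : ℝ → ℝ,
      (∀ τ ∈ Set.Ioo τhat D.τm, ∀ x y : ℝ, D.HugoniotVis τ x y ↔ x = pi τ ∧ y = pe τ) ∧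
      Filter.Tendsto pi (nhdsWithin D.τm (Set.Iio D.τm)) (nhds D.pim) ∧
      Filter.Tendsto pe (nhdsWithin D.τm (Set.Iio D.τm)) (nhds D.pem) ∧
      ∀ τ ∈ Set.Ioo τhat D.τm,
        0 < pi τ ∧ 0 < pe τ ∧ 0 < D.massFluxSq τ (pi τ) (pe τ) ∧
        DifferentiableAt ℝ pi τ ∧ DifferentiableAt ℝ pe τ ∧
        deriv (fun t => TwoTemp.entropy D.γi (pi t) t) τ < 0 ∧
        deriv (fun t => TwoTemp.entropy D.γe (pe t) t) τ < 0 := by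

  have hμ : 0 < D.μ := add_pos hμi hμe
  have hκi : 0 < (D.γi - 1) * (D.μi / D.μ) := mul_pos (sub_pos.2 hγi) (div_pos hμi hμ)
  have hκe : 0 < (D.γe - 1) * (D.μe / D.μ) := mul_pos (sub_pos.2 hγe) (div_pos hμe hμ)
  obtain ⟨ai, ae, ha⟩ := WaveSystem.exists_solution D.γi D.γe ((D.γi - 1) * (D.μi / D.μ))
    ((D.γe - 1) * (D.μe / D.μ)) 0 D.pim D.pem hτ
  obtain ⟨bi, be, hb⟩ := WaveSystem.exists_solution D.γi D.γe ((D.γi - 1) * (D.μi / D.μ))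
    ((D.γe - 1) * (D.μe / D.μ)) 1 0 0 hτ
  have hlim := tendsto_shockFlux hτ ha hb
  set M := shockFlux D.τm D.pim D.pem ai ae bi be with hM
  have hM0 : 0 < (D.γi * D.pim + D.γe * D.pem) / D.τm := by positivity
  have hcurve : ∀ {a b : ℝ → ℝ} {p : ℝ}, a D.τm = p → b D.τm = 0 → ContinuousAt a D.τm →
      ContinuousAt b D.τm → Tendsto (fun t => a t + M t * b t) (𝓝[<] D.τm) (𝓝 p) := by
    intro a b p hap hbp hac hbc
    have := (hac.tendsto.mono_left (nhdsWithin_le_nhds (s := Iio D.τm))).add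
      (hlim.mul (hbc.tendsto.mono_left (nhdsWithin_le_nhds (s := Iio D.τm))))
    simpa [hap, hbp] using this
  have hti := hcurve ha.init_i hb.init_i (ha.ode_i _ hτ).continuousAt (hb.ode_i _ hτ).continuousAt
  have hte := hcurve ha.init_e hb.init_e (ha.ode_e _ hτ).continuousAt (hb.ode_e _ hτ).continuousAt
  obtain ⟨s, hs0, hsT, hs⟩ := exists_hasDerivAt_shockFlux_neg hτ (by linarith) (by linarith)
    hpi hpe ha hb
  -- Positivity of the flux and of both pressures near `τ₋` is inherited from their positive limits.
  obtain ⟨r, hrT, hr⟩ := (mem_nhdsLT_iff_exists_Ioo_subset' hsT).1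
    ((hlim.eventually_const_lt hM0).and
      ((hti.eventually_const_lt hpi).and (hte.eventually_const_lt hpe)))
  have hmem : ∀ t ∈ Ioo (max r s) D.τm, t ∈ Ioo r D.τm ∧ t ∈ Ioo s D.τm := fun t ht =>
    ⟨⟨(le_max_left _ _).trans_lt ht.1, ht.2⟩, ⟨(le_max_right _ _).trans_lt ht.1, ht.2⟩⟩
  refine ⟨max r s, lt_max_of_lt_right hs0, max_lt hrT hsT, fun t => ai t + M t * bi t,
    fun t => ae t + M t * be t, fun t ht x y => ?_, hti, hte, fun t ht => ?_⟩
  · have hts := (hmem t ht).2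
    exact hugoniotVis_iff_eq hγi hγe hμi hμe ha hb (hs0.trans hts.1) hts.2 (hs t hts).1.ne
  · obtain ⟨htr, hts⟩ := hmem t ht
    have ht0 : 0 < t := hs0.trans hts.1
    obtain ⟨hMt, hpit, hpet⟩ := hr htr
    obtain ⟨hG, M', hM', hMd⟩ := hs t hts
    obtain ⟨hbi, hbe⟩ := hb.pos_left hκi hκe hs0 (fun t ht => (hs t ht).1) hts
    have hFG : defect D.τm 0 D.pim D.pem ai ae t + M t * defect D.τm 1 0 0 bi be t = 0 := by
      rw [hM, shockFlux, div_mul_cancel₀ _ hG.ne, add_neg_cancel]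
    refine ⟨hpit, hpet, ?_,
      ((ha.ode_i t ht0).add (hMd.mul (hb.ode_i t ht0))).differentiableAt,
      ((ha.ode_e t ht0).add (hMd.mul (hb.ode_e t ht0))).differentiableAt,
      deriv_entropy_curve_neg hγi ht0 (ha.ode_i t ht0) (hb.ode_i t ht0) hMd hFG hM' hbi hpit,
      deriv_entropy_curve_neg hγe ht0 (ha.ode_e t ht0) (hb.ode_e t ht0) hMd hFG hM' hbe hpet⟩
    rw [(massFluxSq_eq_iff hts.2 hG.ne).2 rfl]
    exact hMt
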